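/- Let $\mathcal Z$ be a measurable space (for instance a subset of $\mathbb R^d$), let $\mathcal T=[0,\tau]$ with $\tau>0$, let $\mathcal Y\subset\mathbb R$ be closed, and let $Y:\mathcal T\to\mathcal Y$ be measurable. Let $L:\mathcal Z\times\mathcal Y\times\mathbb R\to[0,\infty)$ be a measurable loss function that is convex in its last argument and locally Lipschitz: for every $a>0$ there is a constant $c_L(a)$ such that $|L(z,y,s)-L(z,y,s')|\le c_L(a)|s-s'|$ for all $z\in\mathcal Z$, $y\in\mathcal Y$ and $s,s'\in[-a,a]$. Let $H$ be a separable reproducing kernel Hilbert space of real functions on $\mathcal Z$ whose kernel is bounded and measurable on $\mathcal Z\times\mathcal Z$. For $n\ge 1$ and every data set $D=((z_1,u_1,\delta_1),\dots,(z_n,u_n,\delta_n))\in(\mathcal Z\times\mathcal T\times\{0,1\})^n$ let $\hat G_n(\cdot\,|\,\cdot)$ be the estimate, based on $D$, of the survival function of the censoring variable. Assume that the estimation procedure is measurable, that is, $(D,u,z)\mapsto \hat G_n(u|z)$ is measurable on $(\mathcal Z\times\mathcal T\times\{0,1\})^n\times\mathcal T\times\mathcal Z$ for every $n\geq 1$,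 and that $\hat G_n(u|z)>0$ for all $D$, $u$, $z$. Let $\lambda_n>0$ for $n\ge1$, and let $$f^c_{D,\lambda_n}=\operatorname*{argmin}_{f\in H}\ \lambda_n\|f\|_H^2+\frac1n\sum_{i=1}^n L^n_D\big(z_i,u_i,\delta_i,f(z_i)\big),\qquad L^n_D(z,u,\delta,s)=\begin{cases}L(z,Y(u),s)/\hat G_n(u|z),&\delta=1,\\ 0,&\delta=0.\end{cases}$$ Then, for every $n\ge1$: the minimizer $f^c_{D,\lambda_n}$ exists and is unique for every $D$; the censored SVM learning method is measurable, that is, the map $(D,z)\mapsto f^c_{D,\lambda_n}(z)$ is measurable with respect to the minimal completion of the product $\sigma$-field on $(\mathcal Z\times\mathcal T\times\{0,1\})^n\times\mathcal Z$; and the map $D\mapsto f^c_{D,\lambda_n}$ into $H$ (with its Borel $\sigma$-field) is measurable with respect to the minimal completion of the product $\sigma$-field on $(\mathcal Z\times\mathcal T\times\{0,1\})^n$. Here the minimal completion of a $\sigma$-field is the intersection of its completions with respect to all probability measures. -/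

import Mathlib

open MeasureTheory

noncomputable section

namespace CensoredSVM

/-- The minimal (universal) completion of the `σ`-field of a measurable space: the intersection,
over all probability measures `μ`, of the `μ`-completions. -/
def universalCompletion (α : Type*) [MeasurableSpace α] : MeasurableSpace α where
  MeasurableSet' s := ∀ μ : Measure α, IsProbabilityMeasure μ → NullMeasurableSet s μ
  measurableSet_empty _ _ := MeasurableSet.empty.nullMeasurableSet
  measurableSet_compl _ hs μ hμ := (hs μ hμ).compl
  measurableSet_iUnion _ hs μ hμ := NullMeasurableSet.iUnion fun i => hs i μ hμ

/-- A loss function: a measurable function `Z × 𝒴 × ℝ → [0, ∞)`. -/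
structure IsLoss {Z : Type*} [MeasurableSpace Z] {𝒴 : Set ℝ} (L : Z → 𝒴 → ℝ → ℝ) : Prop where
  measurable : Measurable fun p : Z × 𝒴 × ℝ => L p.1 p.2.1 p.2.2
  nonneg : ∀ z y s, 0 ≤ L z y s

/-- A loss is convex if it is convex in its last argument. -/
def IsConvexLoss {Z : Type*} {𝒴 : Set ℝ} (L : Z → 𝒴 → ℝ → ℝ) : Prop :=
  ∀ z y, ConvexOn ℝ Set.univ (L z y)

/-- A loss is locally Lipschitz if, for every `a > 0`, it is Lipschitz in its last argument on
`[-a, a]`, with a constant `c a` that is uniform in the first two arguments. -/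
def IsLocallyLipschitzLoss {Z : Type*} {𝒴 : Set ℝ} (L : Z → 𝒴 → ℝ → ℝ) : Prop :=
  ∃ c : ℝ → ℝ, ∀ a > 0, ∀ z y, ∀ s ∈ Set.Icc (-a) a, ∀ s' ∈ Set.Icc (-a) a,
    |L z y s - L z y s'| ≤ c a * |s - s'|

/-- The real-valued reproducing kernel of a reproducing kernel Hilbert space of real functions. -/
def realKernel {Z : Type*} (H : Type*) [NormedAddCommGroup H] [InnerProductSpace ℝ H]
    [CompleteSpace H] [RKHS ℝ H Z ℝ] (z z' : Z) : ℝ :=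
  RKHS.kernel H z z' 1

/-- The kernel of the reproducing kernel Hilbert space `H` is bounded and measurable. -/
structure HasBoundedMeasurableKernel {Z : Type*} [MeasurableSpace Z] (H : Type*)
    [NormedAddCommGroup H] [InnerProductSpace ℝ H] [CompleteSpace H] [RKHS ℝ H Z ℝ] : Prop where
  bounded : ∃ B : ℝ, ∀ z z' : Z, |realKernel H z z'| ≤ B
  measurable : Measurable fun p : Z × Z => realKernel H p.1 p.2

/-- A right censored observation `(z, u, δ)`, with covariate `z`, observed time `u ∈ [0, τ]`, and
failure indicator `δ ∈ {0, 1}`. -/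
abbrev Obs (Z : Type*) (τ : ℝ) : Type _ := Z × Set.Icc (0 : ℝ) τ × Fin 2

/-- A procedure that estimates the survival function of the censoring variable: it maps every data
set `D` of size `n` to a function `(u, z) ↦ Ĝₙ(u | z)` on `[0, τ] × Z`. -/
abbrev CensoringEstimator (Z : Type*) (τ : ℝ) : Type _ :=
  (n : ℕ) → (Fin n → Obs Z τ) → Set.Icc (0 : ℝ) τ → Z → ℝ

/-- The estimation procedure is measurable: for every sample size, `(D, u, z) ↦ Ĝₙ(u | z)` is
jointly measurable. -/
def CensoringEstimator.IsMeasurable {Z : Type*} [MeasurableSpace Z] {τ : ℝ}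
    (G : CensoringEstimator Z τ) : Prop :=
  ∀ n ≥ 1, Measurable fun p : (Fin n → Obs Z τ) × Set.Icc (0 : ℝ) τ × Z => G n p.1 p.2.1 p.2.2

/-- The loss `Lⁿ_D(z, u, δ, s)`: the loss `L(z, Y(u), s)` weighted by the inverse of the estimated
probability of censoring after `u` if `δ = 1`, and `0` if `δ = 0`. -/
def censoredLoss {Z : Type*} {τ : ℝ} {𝒴 : Set ℝ} (L : Z → 𝒴 → ℝ → ℝ)
    (Y : Set.Icc (0 : ℝ) τ → 𝒴) (G : CensoringEstimator Z τ) {n : ℕ} (D : Fin n → Obs Z τ)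
    (x : Obs Z τ) (s : ℝ) : ℝ :=
  if x.2.2 = 1 then L x.1 (Y x.2.1) s / G n D x.2.1 x.1 else 0

/-- The objective `lam ‖f‖² + (1/n) ∑ᵢ Lⁿ_D(zᵢ, uᵢ, δᵢ, f(zᵢ))` of the censored SVM. -/
def objective {Z : Type*} {τ : ℝ} {𝒴 : Set ℝ} {H : Type*} [NormedAddCommGroup H]
    [InnerProductSpace ℝ H] [RKHS ℝ H Z ℝ] (L : Z → 𝒴 → ℝ → ℝ) (Y : Set.Icc (0 : ℝ) τ → 𝒴)
    (G : CensoringEstimator Z τ) (lam : ℝ) {n : ℕ} (D : Fin n → Obs Z τ) (f : H) : ℝ :=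
  lam * ‖f‖ ^ 2 + (1 / (n : ℝ)) * ∑ i, censoredLoss L Y G D (D i) (f (D i).1)

/-- The empirical censored SVM decision function: a minimizer over `H` of the objective (an
arbitrary element of `H` if there is no minimizer). -/
def decisionFunction {Z : Type*} {τ : ℝ} {𝒴 : Set ℝ} (H : Type*) [NormedAddCommGroup H]
    [InnerProductSpace ℝ H] [RKHS ℝ H Z ℝ] (L : Z → 𝒴 → ℝ → ℝ) (Y : Set.Icc (0 : ℝ) τ → 𝒴)
    (G : CensoringEstimator Z τ) (lam : ℝ) {n : ℕ} (D : Fin n → Obs Z τ) : H :=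
  Classical.epsilon fun f : H => ∀ g : H, objective L Y G lam D f ≤ objective L Y G lam D g

/-- A censored learning method maps every data set to a real function on `Z`. -/
abbrev CensoredLearningMethod (Z : Type*) (τ : ℝ) : Type _ :=
  (n : ℕ) → (Fin n → Obs Z τ) → Z → ℝ

/-- A censored learning method is measurable if, for every `n ≥ 1`, the map `(D, z) ↦ f_D(z)` is
measurable with respect to the minimal completion of the product `σ`-field. -/
def CensoredLearningMethod.IsMeasurable {Z : Type*} [MeasurableSpace Z] {τ : ℝ}
    (M : CensoredLearningMethod Z τ) : Prop :=
  ∀ n ≥ 1, Measurable[universalCompletion ((Fin n → Obs Z τ) × Z), borel ℝ]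
    fun p : (Fin n → Obs Z τ) × Z => M n p.1 p.2

/-- The censored SVM learning method with regularization sequence `lam`. -/
def learningMethod {Z : Type*} {τ : ℝ} {𝒴 : Set ℝ} (H : Type*) [NormedAddCommGroup H]
    [InnerProductSpace ℝ H] [RKHS ℝ H Z ℝ] (L : Z → 𝒴 → ℝ → ℝ) (Y : Set.Icc (0 : ℝ) τ → 𝒴)
    (G : CensoringEstimator Z τ) (lam : ℕ → ℝ) : CensoredLearningMethod Z τ :=
  fun n D => decisionFunction H L Y G (lam n) D

end CensoredSVM

end

open Filter Topology Set

namespace CensoredSVM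

/-! The objective is continuous, nonnegative and strongly convex, the last because of the term `lam
‖f‖²`. By `dist_le_of_strongConvexOn`, points whose values are within `ε` of the infimum are `O(√ε)`
apart. Hence minimizing sequences are Cauchy and the minimizer is unique. The same estimate replaces
a measurable selection theorem: near-minimizers picked measurably from a countable dense set
converge to the minimizer, which is thus Borel in `D`. Composing with the jointly measurable
evaluation on `H × Z` handles `(D, z)`. Measurability thus holds already for the product `σ`-fields,
and passing to the completion only enlarges them. -/

lemma le_universalCompletion (α : Type*) [m : MeasurableSpace α] : m ≤ universalCompletion α :=
  fun _ hs _ _ => MeasurableSet.nullMeasurableSet hs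

section StronglyConvex

variable {H : Type*} [NormedAddCommGroup H] [InnerProductSpace ℝ H]

/-- Two points at which a strongly convex function is within `ε` of a lower bound are close. -/
lemma dist_le_of_strongConvexOn {F : H → ℝ} {m c ε : ℝ} (hm : 0 < m)
    (hF : StrongConvexOn univ m F) (hc : ∀ h, c ≤ F h) {x y : H} (hx : F x ≤ c + ε)
    (hy : F y ≤ c + ε) : dist x y ≤ √(8 / m * ε) := by
  -- At the midpoint, strong convexity gains `m / 8 * ‖x - y‖ ^ 2`, while the value there is still
  -- at least `c`.
  have h := hF.2 (mem_univ x) (mem_univ y) (one_half_pos (α := ℝ)).le one_half_pos.le (add_halves 1)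
  have h' := hc ((1 / 2 : ℝ) • x + (1 / 2 : ℝ) • y)
  simp only [smul_eq_mul] at h
  rw [dist_eq_norm]
  apply Real.le_sqrt_of_sq_le
  rw [div_mul_eq_mul_div, le_div_iff₀ hm]
  linarith

lemma tendsto_sqrt_mul_one_div_add_one (a : ℝ) :
    Tendsto (fun n : ℕ => √(a * (1 / ((n : ℝ) + 1)))) atTop (𝓝 0) := by
  simpa using ((tendsto_one_div_add_atTop_nhds_zero_nat (𝕜 := ℝ)).const_mul a).sqrt

/-- A continuous strongly convex function on a Hilbert space which is bounded below has a unique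
minimizer. -/
lemma existsUnique_isMin_of_strongConvexOn [CompleteSpace H] {F : H → ℝ} {m : ℝ} (hm : 0 < m)
    (hF : StrongConvexOn univ m F) (hcont : Continuous F) (hbdd : BddBelow (range F)) :
    ∃! f : H, ∀ g : H, F f ≤ F g := by
  have hc : ∀ h, ⨅ g, F g ≤ F h := fun h => ciInf_le hbdd h
  have hex : ∀ n : ℕ, ∃ u, F u < (⨅ g, F g) + 1 / ((n : ℝ) + 1) := fun n =>
    exists_lt_of_ciInf_lt (lt_add_of_pos_right _ Nat.one_div_pos_of_nat)
  choose u hu using hex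
  have hanti : ∀ {n N : ℕ}, N ≤ n → F (u n) ≤ (⨅ g, F g) + 1 / ((N : ℝ) + 1) := fun h =>
    (hu _).le.trans (by gcongr)
  have hcau : CauchySeq u := cauchySeq_of_le_tendsto_0 _
    (fun n k N hn hk => dist_le_of_strongConvexOn hm hF hc (hanti hn) (hanti hk))
    (tendsto_sqrt_mul_one_div_add_one _)
  obtain ⟨f, hf⟩ := cauchySeq_tendsto_of_complete hcau
  have hmin : F f ≤ ⨅ g, F g := by
    refine le_of_tendsto_of_tendsto' ((hcont.tendsto f).comp hf) ?_ (fun n => (hu n).le)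
    simpa using (tendsto_one_div_add_atTop_nhds_zero_nat (𝕜 := ℝ)).const_add (⨅ g, F g)
  refine ⟨f, fun g => hmin.trans (hc g), fun g hg => ?_⟩
  have := dist_le_of_strongConvexOn (ε := 0) hm hF hc (x := g) (y := f)
    (by simpa using (hg f).trans hmin) (by simpa using hmin)
  simpa using this

/-- The minimizer of a strongly convex function on a separable Hilbert space depends measurably on
a parameter. -/
lemma measurable_of_isMin_of_strongConvexOn {α : Type*} [MeasurableSpace α]
    [TopologicalSpace.SeparableSpace H] [MeasurableSpace H] [BorelSpace H]
    {F : α → H → ℝ} {m : ℝ} (hm : 0 < m) (hF : ∀ a, StrongConvexOn univ m (F a))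
    (hcont : ∀ a, Continuous (F a)) (hmeas : ∀ h, Measurable fun a => F a h)
    {x : α → H} (hx : ∀ a h, F a (x a) ≤ F a h) : Measurable x := by
  classical
  let q := TopologicalSpace.denseSeq H
  have happrox : ∀ a, ∀ ε > 0, ∃ k, F a (q k) < F a (x a) + ε := fun a ε hε =>
    (TopologicalSpace.denseRange_denseSeq H).exists_mem_open
      (isOpen_lt (hcont a) continuous_const) ⟨x a, lt_add_of_pos_right _ hε⟩
  have hinf : Measurable fun a => F a (x a) := by
    have heq : (fun a => F a (x a)) = fun a => ⨅ k, F a (q k) := by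
      ext a
      refine le_antisymm (le_ciInf fun k => hx a _) (le_of_forall_pos_le_add fun ε hε => ?_)
      obtain ⟨k, hk⟩ := happrox a ε hε
      exact (ciInf_le ⟨F a (x a), forall_mem_range.2 fun k => hx a _⟩ k).trans hk.le
    rw [heq]
    exact Measurable.iInf fun k => hmeas _
  have hex : ∀ (n : ℕ) (a : α), ∃ k, F a (q k) < F a (x a) + 1 / ((n : ℝ) + 1) := fun n a =>
    happrox a _ Nat.one_div_pos_of_nat
  -- The first index achieving the tolerance depends measurably on `a`, as each comparison involves
  -- measurable functions only.
  refine measurable_of_tendsto_metrizable (f := fun n a => q (Nat.find (hex n a)))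
    (fun n => Measurable.find (f := fun k _ => q k) (fun _ => measurable_const)
      (fun k => measurableSet_lt (hmeas _) (hinf.add_const _)) (hex n))
    (tendsto_pi_nhds.2 fun a => ?_)
  refine tendsto_iff_dist_tendsto_zero.2 (squeeze_zero (fun _ => dist_nonneg) (fun n => ?_)
    (tendsto_sqrt_mul_one_div_add_one (8 / m)))
  exact dist_le_of_strongConvexOn hm (hF a) (hx a) (Nat.find_spec (hex n a)).le
    (le_add_of_nonneg_right Nat.one_div_pos_of_nat.le)

end StronglyConvex

section RKHS

variable {Z : Type*} [MeasurableSpace Z] {H : Type*} [NormedAddCommGroup H]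
  [InnerProductSpace ℝ H] [CompleteSpace H] [RKHS ℝ H Z ℝ]

/-- The functions of a reproducing kernel Hilbert space with measurable kernel are measurable. -/
lemma measurable_coe_of_measurable_realKernel
    (hk : Measurable fun p : Z × Z => realKernel H p.1 p.2) (f : H) : Measurable f := by
  -- Kernel sections span a dense subspace, and norm convergence implies pointwise convergence.
  have hf : f ∈ (Submodule.span ℝ {RKHS.kerFun H x v | (x : Z) (v : ℝ)}).topologicalClosure := by
    rw [RKHS.kerFun_dense]; trivial
  obtain ⟨u, hu, hlim⟩ := mem_closure_iff_seq_limit.1 hf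
  refine measurable_of_tendsto_metrizable (f := fun n => ⇑(u n)) (fun n => ?_)
    (tendsto_pi_nhds.2 fun z => ((RKHS.continuous_eval z).tendsto f).comp hlim)
  refine Submodule.span_induction (p := fun (g : H) _ => Measurable g) ?_ ?_ ?_ ?_ (hu n)
  · rintro _ ⟨x, v, rfl⟩
    have : ⇑(RKHS.kerFun H x v) = fun z => v * realKernel H z x := by
      ext z
      rw [RKHS.kerFun_apply, realKernel, ← smul_eq_mul, ← map_smul, smul_eq_mul, mul_one]
    rw [this]
    exact (hk.comp (measurable_id.prodMk measurable_const)).const_mul v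
  · rw [RKHS.coe_zero]
    exact measurable_const
  · intro g h _ _ hg hh
    simpa using hg.add hh
  · intro c g _ hg
    simpa using hg.const_smul c

/-- On a separable reproducing kernel Hilbert space with measurable kernel, the evaluation
`(f, z) ↦ f z` is jointly measurable. -/
lemma measurable_uncurry_eval [TopologicalSpace.SeparableSpace H] [MeasurableSpace H]
    [BorelSpace H] (hk : Measurable fun p : Z × Z => realKernel H p.1 p.2) :
    Measurable fun p : H × Z => p.1 p.2 := by
  have : SecondCountableTopology H := UniformSpace.secondCountable_of_separable H
  -- Evaluation is a Carathéodory function: continuous in `f`, measurable in `z`.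
  exact measurable_uncurry_of_continuous_of_measurable (u := fun (f : H) (z : Z) => f z)
    RKHS.continuous_eval (measurable_coe_of_measurable_realKernel hk)

end RKHS

section Objective

variable {Z : Type*} {τ : ℝ} {𝒴 : Set ℝ} {L : Z → 𝒴 → ℝ → ℝ} {Y : Set.Icc (0 : ℝ) τ → 𝒴}
  {G : CensoringEstimator Z τ} {n : ℕ}

lemma IsLocallyLipschitzLoss.continuous (hL : IsLocallyLipschitzLoss L) (z : Z) (y : 𝒴) :
    Continuous (L z y) := by
  obtain ⟨c, hc⟩ := hL
  refine continuous_iff_continuousAt.2 fun s => ?_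
  have ha : 0 < |s| + 1 := by positivity
  -- The radius `|s| + 1` puts `s` in the interior; `toNNReal` is needed because the sign of `c` is
  -- not prescribed.
  have hlip : LipschitzOnWith (c (|s| + 1)).toNNReal (L z y) (Icc (-(|s| + 1)) (|s| + 1)) :=
    LipschitzOnWith.of_dist_le_mul fun t ht t' ht' => by
      rw [Real.dist_eq, Real.dist_eq]
      exact (hc _ ha z y t ht t' ht').trans (by gcongr; exact Real.le_coe_toNNReal _)
  refine hlip.continuousOn.continuousAt (Icc_mem_nhds ?_ ?_)
  · linarith [neg_abs_le s]
  · linarith [le_abs_self s]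

lemma continuous_censoredLoss (hL : IsLocallyLipschitzLoss L) (D : Fin n → Obs Z τ)
    (x : Obs Z τ) : Continuous (censoredLoss L Y G D x) := by
  unfold censoredLoss
  split_ifs
  · exact (hL.continuous _ _).div_const _
  · exact continuous_const

lemma convexOn_censoredLoss (hL : IsConvexLoss L) {D : Fin n → Obs Z τ}
    (hG : ∀ u z, 0 < G n D u z) (x : Obs Z τ) : ConvexOn ℝ univ (censoredLoss L Y G D x) := by
  unfold censoredLoss
  split_ifs
  · simpa [div_eq_inv_mul] using (hL x.1 (Y x.2.1)).smul (inv_nonneg.2 (hG x.2.1 x.1).le)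
  · exact convexOn_const _ convex_univ

variable {H : Type*} [NormedAddCommGroup H] [InnerProductSpace ℝ H] [RKHS ℝ H Z ℝ]

lemma continuous_objective (hL : IsLocallyLipschitzLoss L) (lam : ℝ) (D : Fin n → Obs Z τ) :
    Continuous fun f : H => objective L Y G lam D f := by
  unfold objective
  have h := fun i => (continuous_censoredLoss (Y := Y) (G := G) hL D (D i)).comp
    (RKHS.continuous_eval (H := H) (D i).1)
  exact (continuous_const.mul (continuous_norm.pow 2)).add
    (continuous_const.mul (continuous_finsetSum _ fun i _ => h i))

/-- Subtracting `lam * ‖f‖ ^ 2` leaves the averaged losses, which are convex because evaluation at a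
point is linear in `f`. -/
lemma strongConvexOn_objective (hL : IsConvexLoss L) (lam : ℝ) {D : Fin n → Obs Z τ}
    (hG : ∀ u z, 0 < G n D u z) :
    StrongConvexOn univ (2 * lam) fun f : H => objective L Y G lam D f := by
  rw [strongConvexOn_iff_convex]
  have hi : ∀ i, ConvexOn ℝ univ fun f : H => censoredLoss L Y G D (D i) (f (D i).1) := fun i => by
    have := (convexOn_censoredLoss (Y := Y) hL hG (D i)).comp_linearMap
      ((LinearMap.proj (D i).1).comp (RKHS.coeCLM ℝ (H := H) (X := Z) (V := ℝ)).toLinearMap)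
    exact this
  have hsum : ConvexOn ℝ univ fun f : H => ∑ i, censoredLoss L Y G D (D i) (f (D i).1) := by
    have := Finset.sum_induction (s := Finset.univ)
      (fun i => fun f : H => censoredLoss L Y G D (D i) (f (D i).1)) (ConvexOn ℝ univ)
      (fun _ _ h h' => h.add h') (convexOn_const 0 convex_univ) (fun i _ => hi i)
    convert this using 1
    ext f
    simp
  have := hsum.smul (c := 1 / (n : ℝ)) (by positivity)
  refine this.congr fun f _ => ?_
  simp only [objective, smul_eq_mul]
  ring

variable [MeasurableSpace Z]

lemma censoredLoss_nonneg (hL : IsLoss L) {D : Fin n → Obs Z τ} (hG : ∀ u z, 0 < G n D u z)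
    (x : Obs Z τ) (s : ℝ) : 0 ≤ censoredLoss L Y G D x s := by
  unfold censoredLoss
  split_ifs
  · exact div_nonneg (hL.nonneg _ _ _) (hG _ _).le
  · exact le_rfl

lemma objective_nonneg (hL : IsLoss L) {lam : ℝ} (hlam : 0 ≤ lam) {D : Fin n → Obs Z τ}
    (hG : ∀ u z, 0 < G n D u z) (f : H) : 0 ≤ objective L Y G lam D f := by
  have := Finset.sum_nonneg fun i (_ : i ∈ Finset.univ) =>
    censoredLoss_nonneg (Y := Y) hL hG (D i) (f (D i).1)
  unfold objective
  positivity

lemma measurable_objective [CompleteSpace H] (hL : IsLoss L) (hY : Measurable Y)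
    (hk : Measurable fun p : Z × Z => realKernel H p.1 p.2) (hn : 1 ≤ n) (hG : G.IsMeasurable)
    (lam : ℝ) (f : H) : Measurable fun D : Fin n → Obs Z τ => objective L Y G lam D f := by
  unfold objective censoredLoss
  have hf := measurable_coe_of_measurable_realKernel hk f
  refine ((Finset.measurable_sum _ fun i _ => ?_).const_mul _).const_add _
  have hD : Measurable fun D : Fin n → Obs Z τ => D i := measurable_pi_apply i
  have hz := hD.fst
  have hu := hD.snd.fst
  refine Measurable.ite (hD.snd.snd (measurableSet_singleton 1)) (Measurable.div ?_ ?_)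
    measurable_const
  · exact hL.measurable.comp (hz.prodMk ((hY.comp hu).prodMk (hf.comp hz)))
  · exact (hG n hn).comp (measurable_id.prodMk (hu.prodMk hz))

end Objective

end CensoredSVM

open CensoredSVM in
theorem mainTheorem6 {Z : Type*} [MeasurableSpace Z] (τ : ℝ) (hτ : 0 < τ)
    (𝒴 : Set ℝ) (h𝒴 : IsClosed 𝒴)
    (Y : Set.Icc (0 : ℝ) τ → 𝒴) (hY : Measurable Y)
    (L : Z → 𝒴 → ℝ → ℝ) (hL : CensoredSVM.IsLoss L)
    (hLconv : CensoredSVM.IsConvexLoss L) (hLlip : CensoredSVM.IsLocallyLipschitzLoss L)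
    (H : Type*) [NormedAddCommGroup H] [InnerProductSpace ℝ H] [CompleteSpace H]
    [TopologicalSpace.SeparableSpace H] [RKHS ℝ H Z ℝ]
    (hH : CensoredSVM.HasBoundedMeasurableKernel H)
    (G : CensoredSVM.CensoringEstimator Z τ) (hG : G.IsMeasurable)
    (hGpos : ∀ n ≥ 1, ∀ (D : Fin n → CensoredSVM.Obs Z τ) (u : Set.Icc (0 : ℝ) τ) (z : Z),
      0 < G n D u z)
    (lam : ℕ → ℝ) (hlam : ∀ n ≥ 1, 0 < lam n) :
    (∀ n ≥ 1, ∀ D : Fin n → CensoredSVM.Obs Z τ, ∃! f : H, ∀ g : H,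
      CensoredSVM.objective L Y G (lam n) D f ≤ CensoredSVM.objective L Y G (lam n) D g) ∧
    (CensoredSVM.learningMethod H L Y G lam).IsMeasurable ∧
    (∀ n ≥ 1, Measurable[CensoredSVM.universalCompletion (Fin n → CensoredSVM.Obs Z τ), borel H]
      fun D : Fin n → CensoredSVM.Obs Z τ =>
        CensoredSVM.decisionFunction H L Y G (lam n) D) := by

  have huniq : ∀ n ≥ 1, ∀ D : Fin n → Obs Z τ, ∃! f : H, ∀ g : H,
      objective L Y G (lam n) D f ≤ objective L Y G (lam n) D g := fun n hn D =>
    existsUnique_isMin_of_strongConvexOn (mul_pos two_pos (hlam n hn))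
      (strongConvexOn_objective hLconv _ (hGpos n hn D)) (continuous_objective hLlip _ D)
      ⟨0, forall_mem_range.2 (objective_nonneg hL (hlam n hn).le (hGpos n hn D))⟩
  borelize H
  have hmeas : ∀ n ≥ 1, Measurable fun D : Fin n → Obs Z τ =>
      decisionFunction H L Y G (lam n) D := fun n hn =>
    measurable_of_isMin_of_strongConvexOn (mul_pos two_pos (hlam n hn))
      (fun D => strongConvexOn_objective hLconv _ (hGpos n hn D))
      (fun D => continuous_objective hLlip _ D)
      (measurable_objective hL hY hH.measurable hn hG _)
      -- Existence rules out the junk value of `Classical.epsilon`.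
      (fun D => Classical.epsilon_spec (huniq n hn D).exists)
  refine ⟨huniq, fun n hn => ?_, fun n hn => ?_⟩
  · rw [← BorelSpace.measurable_eq (α := ℝ)]
    have h : Measurable fun p : (Fin n → Obs Z τ) × Z =>
        decisionFunction H L Y G (lam n) p.1 p.2 :=
      (measurable_uncurry_eval hH.measurable).comp
        (((hmeas n hn).comp measurable_fst).prodMk measurable_snd)
    exact h.mono (le_universalCompletion _) le_rfl
  · exact (hmeas n hn).mono (le_universalCompletion _) le_rfl
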